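/- Let $V$ be a finite-dimensional complex Hilbert space, with inner product $\langle\cdot|\cdot\rangle$ antilinear in the first variable. Give the symmetric algebra $SV=\bigoplus_{d\ge 0}S^dV$ the inner product for which the summands $S^dV$ are mutually perpendicular and $\langle x_1\cdots x_d\,|\,y_1\cdots y_d\rangle=\sum_{p}\prod_{j=1}^d\langle x_j|y_{p(j)}\rangle$ ($p$ running over all permutations of $\{1,\dots,d\}$). Let $SV'$ be the space of all antilinear functionals $SV\to\mathbb C$, and let the Fock space $S[V]$ be the Hilbert space completion of $SV$, identified with a subspace of $SV'$ by $\Phi\mapsto\langle\,\cdot\,|\Phi\rangle$. An antilinear map $Z:V\to V$ is symmetric if $\langle y|Zx\rangle=\langle x|Zy\rangle$ for all $x,y\in V$; in that case let $\zeta\in S^2V$ be the unique element with $\langle y|Zx\rangle=\langle xy|\zeta\rangle$ for all $x,y\in V$, and define the Gaussian $e^Z=\sum_{d\ge 0}\zeta^d/d!\in SV'$, that is, $e^Z(\theta)=\sum_{d\ge0}\langle\theta|\zeta^d\rangle/d!$ for $\theta\in SV$ (a finite sum). Let $\mathcal D(V)$ be the set of symmetric antilinear $Z$ with operator norm $\|Z\|<1$.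 Let $\mathcal G(V)$ be the set of complex-linear maps $T:V\to V$ with $\operatorname{Re}\langle v|Tv\rangle>0$ for all $v\neq 0$, and let $\mathrm{Det}^{1/2}:\mathcal G(V)\to\mathbb C$ be the holomorphic function with $(\mathrm{Det}^{1/2}(T))^2=\mathrm{Det}(T)$ for all $T \in \mathcal G(V)$ and $\mathrm{Det}^{1/2}(I)=1$. If $X,Y\in\mathcal D(V)$, then $e^X$ and $e^Y$ lie in $S[V]$, $I-YX$ lies in $\mathcal G(V)$, and $$\langle e^X\,|\,e^Y\rangle=\mathrm{Det}^{1/2}(I-YX)^{-1}.$$ -/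

import Mathlib

open scoped ComplexConjugate InnerProductSpace

namespace BosonicFock

section Polynomial

variable {σ : Type*}

/-- The bilinear pairing of polynomials in which the monomials are orthogonal and
`X ^ D` pairs with itself to `D! = ∏ i, (D i)!`. -/
noncomputable def polyPairing :
    MvPolynomial σ ℂ →ₗ[ℂ] MvPolynomial σ ℂ →ₗ[ℂ] ℂ :=
  (MvPolynomial.basisMonomials σ ℂ).constr ℂ
    fun D => (D.prod fun _ k => ((k.factorial : ℕ) : ℂ)) • MvPolynomial.lcoeff (R := ℂ) D

theorem polyPairing_monomial (D : σ →₀ ℕ) (a : ℂ) (q : MvPolynomial σ ℂ) :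
    polyPairing (MvPolynomial.monomial D a) q =
      a * ((D.prod fun _ k => ((k.factorial : ℕ) : ℂ)) * q.coeff D) := by
  have h : (MvPolynomial.monomial D a : MvPolynomial σ ℂ)
      = a • MvPolynomial.basisMonomials σ ℂ D := by
    simp [MvPolynomial.smul_monomial]
  rw [h, map_smul, polyPairing, Module.Basis.constr_basis]
  simp [MvPolynomial.lcoeff]

theorem polyPairing_X_mul (i : σ) (p q : MvPolynomial σ ℂ) :
    polyPairing (MvPolynomial.X i * p) q = polyPairing p (MvPolynomial.pderiv i q) := by
  classical
  induction p using MvPolynomial.induction_on' with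
  | add p₁ p₂ h₁ h₂ => simp [mul_add, h₁, h₂]
  | monomial D a =>
    have hX : (MvPolynomial.X i * MvPolynomial.monomial D a : MvPolynomial σ ℂ)
        = MvPolynomial.monomial (D + Finsupp.single i 1) a := by
      rw [MvPolynomial.X, MvPolynomial.monomial_mul, one_mul, add_comm]
    rw [hX, polyPairing_monomial, polyPairing_monomial, MvPolynomial.coeff_pderiv]
    have hf : ((D + Finsupp.single i 1).prod fun _ k => ((k.factorial : ℕ) : ℂ))
        = (D.prod fun _ k => ((k.factorial : ℕ) : ℂ)) * (D i + 1) := by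
      set s := insert i D.support with hs
      have h1 : (D + Finsupp.single i 1).support ⊆ s := by
        intro j hj
        by_cases hji : j = i
        · simp [hs, hji]
        · simp only [hs, Finset.mem_insert, Finsupp.mem_support_iff, Finsupp.add_apply] at hj ⊢
          rw [Finsupp.single_eq_of_ne hji] at hj
          right; simpa using hj
      rw [Finsupp.prod_of_support_subset _ h1 _ (by simp),
        Finsupp.prod_of_support_subset D (Finset.subset_insert i _) _ (by simp),
        ← Finset.mul_prod_erase s _ (Finset.mem_insert_self i _),
        ← Finset.mul_prod_erase s (fun j => (((D j).factorial : ℕ) : ℂ))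
          (Finset.mem_insert_self i _)]
      have h2 : ∀ j ∈ s.erase i, ((((D + Finsupp.single i 1 : σ →₀ ℕ) j).factorial : ℕ) : ℂ)
          = (((D j).factorial : ℕ) : ℂ) := by
        intro j hj
        rw [Finsupp.add_apply, Finsupp.single_eq_of_ne (Finset.ne_of_mem_erase hj), add_zero]
      rw [Finset.prod_congr rfl h2]
      simp only [Finsupp.add_apply, Finsupp.single_eq_same, Nat.factorial_succ]
      push_cast
      ring
    rw [hf]
    ring

theorem derivation_prod {A : Type*} [CommRing A] [Algebra ℂ A] (δ : Derivation ℂ A A)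
    {ι : Type*} [DecidableEq ι] (s : Finset ι) (f : ι → A) :
    δ (∏ j ∈ s, f j) = ∑ k ∈ s, δ (f k) * ∏ j ∈ s.erase k, f j := by
  induction s using Finset.induction_on with
  | empty => simp
  | insert a s ha ih =>
    rw [Finset.prod_insert ha, Derivation.leibniz, ih, Finset.sum_insert ha,
      Finset.erase_insert ha, smul_eq_mul, smul_eq_mul, Finset.mul_sum, add_comm, mul_comm]
    congr 1
    refine Finset.sum_congr rfl fun k hk => ?_
    have hka : a ≠ k := fun h => ha (h ▸ hk)
    rw [Finset.erase_insert_of_ne hka, Finset.prod_insert (by simp [ha])]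
    ring

theorem sum_perm_succ {d : ℕ} (M : Fin (d + 1) → Fin (d + 1) → ℂ) :
    ∑ p : Equiv.Perm (Fin (d + 1)), ∏ j, M j (p j) =
      ∑ k, M 0 k * ∑ p : Equiv.Perm (Fin d),
        ∏ j : Fin d, M j.succ (Equiv.swap 0 k (p j).succ) := by
  rw [← Equiv.Perm.decomposeFin.symm.sum_comp, Fintype.sum_prod_type]
  refine Finset.sum_congr rfl fun k _ => ?_
  rw [Finset.mul_sum]
  refine Finset.sum_congr rfl fun p _ => ?_
  rw [Fin.prod_univ_succ]
  simp

theorem prod_erase_swap {A : Type*} [CommRing A] {d : ℕ} (k : Fin (d + 1)) (f : Fin (d + 1) → A) :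
    ∏ j ∈ Finset.univ.erase k, f j = ∏ i : Fin d, f (Equiv.swap 0 k i.succ) := by
  symm
  refine Finset.prod_bij (fun i _ => Equiv.swap 0 k i.succ) ?_ ?_ ?_ ?_
  · intro i _
    simp only [Finset.mem_erase, Finset.mem_univ, and_true]
    intro h
    have := (Equiv.swap (0 : Fin (d + 1)) k).injective (h.trans (Equiv.swap_apply_left 0 k).symm)
    exact Fin.succ_ne_zero i this
  · intro i _ j _ h
    exact Fin.succ_injective _ ((Equiv.swap (0 : Fin (d + 1)) k).injective h)
  · intro j hj
    have hne : Equiv.swap 0 k j ≠ 0 := by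
      intro h
      have : j = k := by
        rw [← Equiv.swap_apply_self 0 k j, h, Equiv.swap_apply_left]
      simp [this] at hj
    obtain ⟨i, hi⟩ := Fin.exists_succ_eq.2 hne
    exact ⟨i, Finset.mem_univ _, by rw [hi, Equiv.swap_apply_self]⟩
  · intros; rfl

end Polynomial

section FockSpace

variable {V : Type*} [NormedAddCommGroup V] [InnerProductSpace ℂ V]

/-- Every element of `SV` is a linear combination of products of vectors. -/
theorem span_prod_eq_top : Submodule.span ℂ {θ : SymmetricAlgebra ℂ V |
    ∃ (d : ℕ) (x : Fin d → V), θ = ∏ j, SymmetricAlgebra.ι ℂ V (x j)} = ⊤ := by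
  rw [eq_top_iff]
  rintro θ -
  induction θ using SymmetricAlgebra.induction with
  | algebraMap r =>
    rw [Algebra.algebraMap_eq_smul_one]
    exact Submodule.smul_mem _ _ (Submodule.subset_span ⟨0, Fin.elim0, by simp⟩)
  | ι x => exact Submodule.subset_span ⟨1, fun _ => x, by simp⟩
  | add a b ha hb => exact Submodule.add_mem _ ha hb
  | mul a b ha hb =>
    have := Submodule.mul_mem_mul ha hb
    rw [Submodule.span_mul_span] at this
    refine Submodule.span_mono ?_ this
    rintro _ ⟨_, ⟨d, x, rfl⟩, _, ⟨e, y, rfl⟩, rfl⟩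
    exact ⟨d + e, Fin.append x y, by simp [Fin.prod_univ_add]⟩

variable [FiniteDimensional ℂ V]

/-- `SV` as a polynomial algebra in the coordinates of an orthonormal basis. -/
noncomputable def toPoly : SymmetricAlgebra ℂ V ≃ₐ[ℂ]
    MvPolynomial (Fin (Module.finrank ℂ V)) ℂ :=
  SymmetricAlgebra.equivMvPolynomial (stdOrthonormalBasis ℂ V).toBasis

theorem toPoly_ι (x : V) : toPoly (SymmetricAlgebra.ι ℂ V x) =
    ∑ i, MvPolynomial.C (⟪stdOrthonormalBasis ℂ V i, x⟫_ℂ) * MvPolynomial.X i := by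
  conv_lhs => rw [← (stdOrthonormalBasis ℂ V).sum_repr' x]
  rw [map_sum, map_sum]
  refine Finset.sum_congr rfl fun i _ => ?_
  rw [map_smul, map_smul, MvPolynomial.C_mul']
  congr 1
  have := SymmetricAlgebra.equivMvPolynomial_ι_apply (stdOrthonormalBasis ℂ V).toBasis i
  simpa [toPoly] using this

/-- The sesquilinear form on `SV` for which the monomials in an orthonormal basis are orthogonal
with squared norm `D!`. -/
noncomputable def coordInner :
    SymmetricAlgebra ℂ V →ₗ⋆[ℂ] SymmetricAlgebra ℂ V →ₗ[ℂ] ℂ :=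
  LinearMap.mk₂'ₛₗ (starRingEnd ℂ) (RingHom.id ℂ)
    (fun θ ψ => polyPairing (MvPolynomial.map (starRingEnd ℂ) (toPoly θ)) (toPoly ψ))
    (by intros; simp)
    (by
      intro c θ ψ
      rw [map_smul, ← MvPolynomial.C_mul', map_mul, MvPolynomial.map_C, MvPolynomial.C_mul',
        map_smul, LinearMap.smul_apply])
    (by intros; simp)
    (by intros; simp)

theorem coordInner_apply (θ ψ : SymmetricAlgebra ℂ V) : coordInner θ ψ =
    polyPairing (MvPolynomial.map (starRingEnd ℂ) (toPoly θ)) (toPoly ψ) := rfl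

/-- The annihilator of `x`: the derivation that sends `y` to `⟨x | y⟩`. -/
noncomputable def polyAnn (x : V) : Derivation ℂ (MvPolynomial (Fin (Module.finrank ℂ V)) ℂ)
    (MvPolynomial (Fin (Module.finrank ℂ V)) ℂ) :=
  ∑ i, ⟪x, stdOrthonormalBasis ℂ V i⟫_ℂ • MvPolynomial.pderiv i

theorem polyAnn_apply (x : V) (q : MvPolynomial (Fin (Module.finrank ℂ V)) ℂ) :
    polyAnn x q = ∑ i, ⟪x, stdOrthonormalBasis ℂ V i⟫_ℂ • MvPolynomial.pderiv i q := by
  have := congrFun (map_sum (Derivation.coeFnAddMonoidHom (R := ℂ)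
    (A := MvPolynomial (Fin (Module.finrank ℂ V)) ℂ)
    (M := MvPolynomial (Fin (Module.finrank ℂ V)) ℂ))
    (fun i => ⟪x, stdOrthonormalBasis ℂ V i⟫_ℂ • MvPolynomial.pderiv i) Finset.univ) q
  rw [Finset.sum_apply] at this
  exact this

theorem polyAnn_ι (x y : V) : polyAnn x (toPoly (SymmetricAlgebra.ι ℂ V y)) =
    MvPolynomial.C ⟪x, y⟫_ℂ := by
  classical
  rw [toPoly_ι, ← (stdOrthonormalBasis ℂ V).sum_inner_mul_inner x y, map_sum,
    map_sum]
  refine Finset.sum_congr rfl fun i _ => ?_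
  rw [polyAnn_apply, Finset.sum_eq_single i]
  · rw [MvPolynomial.pderiv_C_mul, MvPolynomial.pderiv_X_self, mul_one, map_mul,
      ← MvPolynomial.C_mul']
  · intro j _ hj
    rw [MvPolynomial.pderiv_C_mul, MvPolynomial.pderiv_X_of_ne hj.symm, mul_zero, smul_zero]
  · simp

theorem coordInner_ι_mul (x : V) (θ ψ : SymmetricAlgebra ℂ V) :
    coordInner (SymmetricAlgebra.ι ℂ V x * θ) ψ =
      polyPairing (MvPolynomial.map (starRingEnd ℂ) (toPoly θ)) (polyAnn x (toPoly ψ)) := by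
  rw [coordInner_apply, map_mul, map_mul, toPoly_ι, map_sum, Finset.sum_mul, map_sum,
    LinearMap.sum_apply, polyAnn_apply, map_sum]
  refine Finset.sum_congr rfl fun i _ => ?_
  rw [map_mul (MvPolynomial.map (starRingEnd ℂ)), MvPolynomial.map_C, MvPolynomial.map_X, mul_assoc, MvPolynomial.C_mul', map_smul,
    LinearMap.smul_apply, map_smul, polyPairing_X_mul, inner_conj_symm]

theorem coordInner_prod_zero {n : ℕ} (y : Fin (n + 1) → V) :
    coordInner 1 (∏ j, SymmetricAlgebra.ι ℂ V (y j)) = 0 := by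
  have h : ∀ q, polyPairing (1 : MvPolynomial (Fin (Module.finrank ℂ V)) ℂ) q
      = MvPolynomial.constantCoeff q := by
    intro q
    have := polyPairing_monomial (0 : (Fin (Module.finrank ℂ V)) →₀ ℕ) 1 q
    simpa [MvPolynomial.constantCoeff_eq] using this
  rw [coordInner_apply, map_one, map_one, h, Fin.prod_univ_succ, map_mul, map_mul, toPoly_ι]
  simp

theorem polyAnn_prod (x : V) {n : ℕ} (y : Fin (n + 1) → V) :
    polyAnn x (toPoly (∏ j, SymmetricAlgebra.ι ℂ V (y j))) =
      ∑ k, ⟪x, y k⟫_ℂ • toPoly (∏ i : Fin n,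
        SymmetricAlgebra.ι ℂ V (y (Equiv.swap 0 k i.succ))) := by
  rw [map_prod, derivation_prod]
  refine Finset.sum_congr rfl fun k _ => ?_
  rw [polyAnn_ι, prod_erase_swap, MvPolynomial.C_mul', map_prod]

theorem coordInner_prod {d : ℕ} (x y : Fin d → V) :
    coordInner (∏ j, SymmetricAlgebra.ι ℂ V (x j)) (∏ j, SymmetricAlgebra.ι ℂ V (y j)) =
      ∑ p : Equiv.Perm (Fin d), ∏ j, ⟪x j, y (p j)⟫_ℂ := by
  induction d with
  | zero =>
    have := polyPairing_monomial (0 : (Fin (Module.finrank ℂ V)) →₀ ℕ) 1 1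
    simpa [coordInner_apply] using this
  | succ d ih =>
    rw [Fin.prod_univ_succ, coordInner_ι_mul, polyAnn_prod, map_sum,
      sum_perm_succ (fun j k => ⟪x j, y k⟫_ℂ)]
    refine Finset.sum_congr rfl fun k _ => ?_
    rw [map_smul, ← coordInner_apply, ih, smul_eq_mul]

theorem coordInner_prod_ne {d e : ℕ} (hde : d ≠ e) (x : Fin d → V) (y : Fin e → V) :
    coordInner (∏ j, SymmetricAlgebra.ι ℂ V (x j)) (∏ j, SymmetricAlgebra.ι ℂ V (y j)) = 0 := by
  induction d generalizing e with
  | zero =>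
    obtain ⟨e, rfl⟩ := Nat.exists_eq_succ_of_ne_zero hde.symm
    simpa using coordInner_prod_zero y
  | succ d ih =>
    rw [Fin.prod_univ_succ, coordInner_ι_mul]
    cases e with
    | zero => simp
    | succ e =>
      rw [polyAnn_prod, map_sum]
      refine Finset.sum_eq_zero fun k _ => ?_
      rw [map_smul, ← coordInner_apply, ih (by omega), smul_zero]

theorem coordInner_eq_sum (θ ψ : SymmetricAlgebra ℂ V) : coordInner θ ψ =
    ∑ D ∈ (toPoly θ).support, conj ((toPoly θ).coeff D) *
      ((D.prod fun _ k => ((k.factorial : ℕ) : ℂ)) * (toPoly ψ).coeff D) := by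
  rw [coordInner_apply]
  conv_lhs => rw [MvPolynomial.as_sum (toPoly θ)]
  rw [map_sum, map_sum, LinearMap.sum_apply]
  refine Finset.sum_congr rfl fun D _ => ?_
  rw [MvPolynomial.map_monomial, polyPairing_monomial]

variable (V) in
/-- There is exactly one sesquilinear form on `SV` (antilinear in the first variable) for which
products of different degrees are perpendicular and
`⟨x₁ ⋯ x_d | y₁ ⋯ y_d⟩ = ∑ p, ∏ j, ⟨x_j | y_{p j}⟩`, the sum being over all permutations. -/
theorem existsUnique_symInner :
    ∃! B : SymmetricAlgebra ℂ V →ₗ⋆[ℂ] SymmetricAlgebra ℂ V →ₗ[ℂ] ℂ,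
      (∀ (d : ℕ) (x y : Fin d → V),
        B (∏ j, SymmetricAlgebra.ι ℂ V (x j)) (∏ j, SymmetricAlgebra.ι ℂ V (y j)) =
          ∑ p : Equiv.Perm (Fin d), ∏ j, ⟪x j, y (p j)⟫_ℂ) ∧
      (∀ (d e : ℕ), d ≠ e → ∀ (x : Fin d → V) (y : Fin e → V),
        B (∏ j, SymmetricAlgebra.ι ℂ V (x j)) (∏ j, SymmetricAlgebra.ι ℂ V (y j)) = 0) := by
  refine ⟨coordInner, ⟨fun _ => coordInner_prod, fun _ _ => coordInner_prod_ne⟩, ?_⟩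
  rintro B ⟨h1, h2⟩
  refine LinearMap.ext_on span_prod_eq_top ?_
  rintro _ ⟨d, x, rfl⟩
  refine LinearMap.ext_on span_prod_eq_top ?_
  rintro _ ⟨e, y, rfl⟩
  by_cases hde : d = e
  · subst hde
    rw [h1, coordInner_prod]
  · rw [h2 d e hde, coordInner_prod_ne hde]

variable (V) in
/-- The canonical inner product on the symmetric algebra. -/
noncomputable def symInner : SymmetricAlgebra ℂ V →ₗ⋆[ℂ] SymmetricAlgebra ℂ V →ₗ[ℂ] ℂ :=
  (existsUnique_symInner V).choose

theorem symInner_prod {d : ℕ} (x y : Fin d → V) :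
    symInner V (∏ j, SymmetricAlgebra.ι ℂ V (x j)) (∏ j, SymmetricAlgebra.ι ℂ V (y j)) =
      ∑ p : Equiv.Perm (Fin d), ∏ j, ⟪x j, y (p j)⟫_ℂ :=
  (existsUnique_symInner V).choose_spec.1.1 d x y

theorem symInner_prod_ne {d e : ℕ} (hde : d ≠ e) (x : Fin d → V) (y : Fin e → V) :
    symInner V (∏ j, SymmetricAlgebra.ι ℂ V (x j)) (∏ j, SymmetricAlgebra.ι ℂ V (y j)) = 0 :=
  (existsUnique_symInner V).choose_spec.1.2 d e hde x y

variable (V) in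
theorem symInner_eq_coordInner : symInner V = coordInner :=
  ((existsUnique_symInner V).choose_spec.2 coordInner
    ⟨fun _ => coordInner_prod, fun _ _ => coordInner_prod_ne⟩).symm

theorem symInner_conj (θ ψ : SymmetricAlgebra ℂ V) :
    conj (symInner V ψ θ) = symInner V θ ψ := by
  classical
  rw [symInner_eq_coordInner, coordInner_eq_sum, coordInner_eq_sum,
    Finset.sum_subset (Finset.subset_union_left (s₂ := (toPoly θ).support)),
    Finset.sum_subset (Finset.subset_union_right (s₁ := (toPoly ψ).support)
      (s₂ := (toPoly θ).support)), map_sum]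
  · refine Finset.sum_congr rfl fun D _ => ?_
    simp only [map_mul, Complex.conj_conj, Finsupp.prod, map_prod, Complex.conj_natCast]
    ring
  · intro D _ hD
    simp [MvPolynomial.notMem_support_iff.1 hD]
  · intro D _ hD
    simp [MvPolynomial.notMem_support_iff.1 hD]

theorem symInner_self (θ : SymmetricAlgebra ℂ V) : symInner V θ θ =
    ((∑ D ∈ (toPoly θ).support, (D.prod fun _ k => ((k.factorial : ℕ) : ℝ)) *
      ‖(toPoly θ).coeff D‖ ^ 2 : ℝ) : ℂ) := by
  rw [symInner_eq_coordInner, coordInner_eq_sum, Complex.ofReal_sum]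
  refine Finset.sum_congr rfl fun D _ => ?_
  rw [mul_left_comm, Complex.conj_mul']
  simp [Finsupp.prod]

variable (V) in
/-- The canonical inner product on `SV` satisfies the axioms of an inner product. -/
noncomputable abbrev symCore : InnerProductSpace.Core ℂ (SymmetricAlgebra ℂ V) where
  inner θ ψ := symInner V θ ψ
  conj_inner_symm θ ψ := symInner_conj θ ψ
  re_inner_nonneg θ := by
    rw [symInner_self]
    simp only [RCLike.re_to_complex, Complex.ofReal_re, Finsupp.prod]
    positivity
  add_left := by intros; simp
  smul_left := by intros; simp
  definite θ h := by
    rw [symInner_self, Complex.ofReal_eq_zero, Finset.sum_eq_zero_iff_of_nonneg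
      (fun D _ => by simp only [Finsupp.prod]; positivity)] at h
    have : toPoly θ = 0 := by
      by_contra hne
      obtain ⟨D, hD⟩ := MvPolynomial.support_nonempty.2 hne
      have h1 := h D hD
      have h2 : (D.prod fun _ k => ((k.factorial : ℕ) : ℝ)) ≠ 0 := by
        simp only [Finsupp.prod]
        exact Finset.prod_ne_zero_iff.2 fun i _ => by exact_mod_cast Nat.factorial_ne_zero _
      have h3 := (mul_eq_zero.1 h1).resolve_left h2
      exact (MvPolynomial.mem_support_iff.1 hD) (by simpa using h3)
    exact (map_eq_zero_iff toPoly toPoly.injective).1 this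

noncomputable instance symNormed : NormedAddCommGroup (SymmetricAlgebra ℂ V) :=
  (symCore V).toNormedAddCommGroup

noncomputable instance symInnerProductSpace : InnerProductSpace ℂ (SymmetricAlgebra ℂ V) :=
  InnerProductSpace.ofCore (symCore V).toCore

theorem inner_eq_symInner (θ ψ : SymmetricAlgebra ℂ V) : ⟪θ, ψ⟫_ℂ = symInner V θ ψ := rfl

variable (V) in
/-- Bosonic Fock space `S[V]`: the Hilbert space completion of `SV`. -/
abbrev Fock : Type _ := UniformSpace.Completion (SymmetricAlgebra ℂ V)

variable (V) in
/-- The full algebraic antidual `SV'`: all antilinear functionals on `SV`. -/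
abbrev Antidual : Type _ := SymmetricAlgebra ℂ V →ₗ⋆[ℂ] ℂ

variable (V) in
/-- The canonical map `S[V] → SV'`, `Φ ↦ ⟨· | Φ⟩`, identifying Fock space with a space of
antifunctionals. -/
noncomputable def Fock.toAntidual : Fock V →ₗ[ℂ] Antidual V :=
  ((innerₛₗ ℂ (E := Fock V)).comp
    (UniformSpace.Completion.toComplₗᵢ (𝕜 := ℂ) (E := SymmetricAlgebra ℂ V)).toLinearMap).flip

theorem Fock.toAntidual_apply (Φ : Fock V) (θ : SymmetricAlgebra ℂ V) :
    Fock.toAntidual V Φ θ = ⟪(θ : Fock V), Φ⟫_ℂ := rfl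

theorem Fock.toAntidual_injective : Function.Injective (Fock.toAntidual V) := by
  intro Φ Ψ h
  exact UniformSpace.Completion.denseRange_coe.eq_of_inner_right ℂ
    fun θ => LinearMap.congr_fun h θ

variable (V) in
/-- The homogeneous summand `S^d V` of the symmetric algebra. -/
noncomputable def symPower (d : ℕ) : Submodule ℂ (SymmetricAlgebra ℂ V) :=
  LinearMap.range (SymmetricAlgebra.ι ℂ V) ^ d

theorem symPower_le_span (n : ℕ) : symPower V n ≤ Submodule.span ℂ
    {θ : SymmetricAlgebra ℂ V | ∃ x : Fin n → V, θ = ∏ j, SymmetricAlgebra.ι ℂ V (x j)} := by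
  induction n with
  | zero =>
    rw [symPower, pow_zero, Submodule.one_eq_span]
    exact Submodule.span_mono (by rintro _ rfl; exact ⟨Fin.elim0, by simp⟩)
  | succ n ih =>
    rw [symPower, pow_succ']
    refine Submodule.mul_le.2 ?_
    rintro _ ⟨x, rfl⟩ ψ hψ
    have h := ih hψ
    clear hψ
    induction h using Submodule.span_induction with
    | mem ψ h =>
      obtain ⟨y, rfl⟩ := h
      exact Submodule.subset_span ⟨Fin.cons x y, by simp [Fin.prod_univ_succ]⟩
    | zero => simp
    | add a b _ _ ha hb => rw [mul_add]; exact Submodule.add_mem _ ha hb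
    | smul c a _ ha => rw [mul_smul_comm]; exact Submodule.smul_mem _ c ha

theorem symInner_prod_symPower {d n : ℕ} (h : d ≠ n) (x : Fin d → V) {ψ : SymmetricAlgebra ℂ V}
    (hψ : ψ ∈ symPower V n) : symInner V (∏ j, SymmetricAlgebra.ι ℂ V (x j)) ψ = 0 := by
  have := symPower_le_span n hψ
  clear hψ
  induction this using Submodule.span_induction with
  | mem ψ hψ => obtain ⟨y, rfl⟩ := hψ; exact symInner_prod_ne h x y
  | zero => simp
  | add a b _ _ ha hb => rw [map_add, ha, hb, add_zero]
  | smul c a _ ha => rw [map_smul, ha, smul_zero]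

/-- An antilinear map `Z : V → V` is symmetric if `⟨y | Z x⟩ = ⟨x | Z y⟩` for all `x, y`. -/
def IsSymmetricAntilinear (Z : V →L⋆[ℂ] V) : Prop := ∀ x y : V, ⟪y, Z x⟫_ℂ = ⟪x, Z y⟫_ℂ

variable (V) in
/-- The open Siegel domain `𝒟(V)`. -/
def siegelDomain : Set (V →L⋆[ℂ] V) := {Z | IsSymmetricAntilinear Z ∧ ‖Z‖ < 1}

theorem symInner_two (x y u v : V) :
    symInner V (SymmetricAlgebra.ι ℂ V x * SymmetricAlgebra.ι ℂ V y)
      (SymmetricAlgebra.ι ℂ V u * SymmetricAlgebra.ι ℂ V v) =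
      ⟪x, u⟫_ℂ * ⟪y, v⟫_ℂ + ⟪x, v⟫_ℂ * ⟪y, u⟫_ℂ := by
  have := symInner_prod ![x, y] ![u, v]
  rw [sum_perm_succ (fun j k => ⟪![x, y] j, ![u, v] k⟫_ℂ)] at this
  simpa [Fin.prod_univ_two, Fin.sum_univ_two] using this

/-- A symmetric antilinear map `Z` corresponds to a unique quadratic `ζ ∈ S²V`. -/
theorem existsUnique_quadratic {Z : V →L⋆[ℂ] V} (hZ : IsSymmetricAntilinear Z) :
    ∃! ζ : SymmetricAlgebra ℂ V, ζ ∈ symPower V 2 ∧ ∀ x y : V,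
      ⟪y, Z x⟫_ℂ = symInner V (SymmetricAlgebra.ι ℂ V x * SymmetricAlgebra.ι ℂ V y) ζ := by
  set b := stdOrthonormalBasis ℂ V
  have hmem : ∀ u v : V, SymmetricAlgebra.ι ℂ V u * SymmetricAlgebra.ι ℂ V v ∈ symPower V 2 := by
    intro u v
    rw [symPower, pow_two]
    exact Submodule.mul_mem_mul ⟨u, rfl⟩ ⟨v, rfl⟩
  set ξ := (2⁻¹ : ℂ) • ∑ k, SymmetricAlgebra.ι ℂ V (b k) * SymmetricAlgebra.ι ℂ V (Z (b k))
    with hξ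
  have hmemξ : ξ ∈ symPower V 2 :=
    Submodule.smul_mem _ _ (Submodule.sum_mem _ fun k _ => hmem _ _)
  have hspec : ∀ x y : V,
      ⟪y, Z x⟫_ℂ = symInner V (SymmetricAlgebra.ι ℂ V x * SymmetricAlgebra.ι ℂ V y) ξ := by
    intro x y
    have key : ∀ x y : V, ∑ k, ⟪x, b k⟫_ℂ * ⟪y, Z (b k)⟫_ℂ = ⟪y, Z x⟫_ℂ := by
      intro x y
      conv_rhs => rw [← b.sum_repr' x, map_sum, inner_sum]
      refine Finset.sum_congr rfl fun k _ => ?_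
      rw [map_smulₛₗ, inner_smul_right, inner_conj_symm]
    rw [hξ, map_smul, map_sum]
    simp only [symInner_two, Finset.sum_add_distrib]
    rw [key x y, Finset.sum_congr rfl fun k _ => mul_comm ⟪x, Z (b k)⟫_ℂ ⟪y, b k⟫_ℂ, key y x,
      hZ x y, smul_eq_mul]
    ring
  refine ⟨ξ, ⟨hmemξ, hspec⟩, ?_⟩
  rintro ζ ⟨hζ, hζZ⟩
  rw [← sub_eq_zero, ← inner_self_eq_zero (𝕜 := ℂ), inner_eq_symInner]
  have horth : ∀ θ ∈ symPower V 2, symInner V θ (ζ - ξ) = 0 := by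
    intro θ hθ
    rw [symPower, pow_two] at hθ
    induction hθ using Submodule.mul_induction_on' with
    | mem_mul_mem u hu v hv =>
      obtain ⟨x, rfl⟩ := hu
      obtain ⟨y, rfl⟩ := hv
      rw [map_sub, ← hζZ x y, ← hspec x y, sub_self]
    | add u _ v _ hu hv => rw [map_add, LinearMap.add_apply, hu, hv, add_zero]
  exact horth _ (Submodule.sub_mem _ hζ hmemξ)

/-- The quadratic `ζ ∈ S²V` with `⟨y | Z x⟩ = ⟨x y | ζ⟩` for all `x, y`. -/
noncomputable def quadratic (Z : V →L⋆[ℂ] V) (hZ : IsSymmetricAntilinear Z) :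
    SymmetricAlgebra ℂ V := (existsUnique_quadratic hZ).choose

theorem quadratic_mem (Z : V →L⋆[ℂ] V) (hZ : IsSymmetricAntilinear Z) :
    quadratic Z hZ ∈ symPower V 2 := (existsUnique_quadratic hZ).choose_spec.1.1

theorem symInner_quadratic (Z : V →L⋆[ℂ] V) (hZ : IsSymmetricAntilinear Z) (x y : V) :
    symInner V (SymmetricAlgebra.ι ℂ V x * SymmetricAlgebra.ι ℂ V y) (quadratic Z hZ) =
      ⟪y, Z x⟫_ℂ := ((existsUnique_quadratic hZ).choose_spec.1.2 x y).symm

/-- Each `θ ∈ SV` pairs nontrivially with only finitely many powers of a quadratic. -/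
theorem finite_symInner_pow {ζ : SymmetricAlgebra ℂ V} (hζ : ζ ∈ symPower V 2)
    (θ : SymmetricAlgebra ℂ V) : {d : ℕ | symInner V θ (ζ ^ d) ≠ 0}.Finite := by
  have hpow : ∀ d, ζ ^ d ∈ symPower V (2 * d) := by
    intro d
    rw [symPower, pow_mul]
    exact Submodule.pow_mem_pow _ hζ d
  have hθ : θ ∈ Submodule.span ℂ {θ : SymmetricAlgebra ℂ V |
    ∃ (d : ℕ) (x : Fin d → V), θ = ∏ j, SymmetricAlgebra.ι ℂ V (x j)} := by
    rw [span_prod_eq_top]; trivial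
  induction hθ using Submodule.span_induction with
  | mem θ h =>
    obtain ⟨n, x, rfl⟩ := h
    refine (Set.finite_le_nat n).subset fun d hd => ?_
    by_contra hlt
    exact hd (symInner_prod_symPower (by simp only [Set.mem_ofPred_eq] at hlt; omega) x (hpow d))
  | zero => simp
  | add a b _ _ ha hb =>
    refine (ha.union hb).subset fun d hd => ?_
    by_contra hn
    simp only [Set.mem_union, Set.mem_ofPred_eq, not_or, not_not] at hn
    exact hd (by rw [map_add, LinearMap.add_apply, hn.1, hn.2, add_zero])
  | smul c a _ ha =>
    refine ha.subset fun d hd h0 => hd ?_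
    rw [map_smulₛₗ, LinearMap.smul_apply, h0, smul_zero]

/-- The Gaussian `e^Z = ∑ d, ζ^d / d!` in `SV'`, where `ζ` is the quadratic corresponding to `Z`.
On each `θ ∈ SV` the sum has only finitely many nonzero terms. -/
noncomputable def gaussian (Z : V →L⋆[ℂ] V) (hZ : IsSymmetricAntilinear Z) : Antidual V where
  toFun θ := ∑ᶠ d : ℕ, ((d.factorial : ℕ) : ℂ)⁻¹ * symInner V θ (quadratic Z hZ ^ d)
  map_add' θ ψ := by
    have hfin : ∀ θ, (Function.support fun d : ℕ =>
        ((d.factorial : ℕ) : ℂ)⁻¹ * symInner V θ (quadratic Z hZ ^ d)).Finite := fun θ =>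
      (finite_symInner_pow (quadratic_mem Z hZ) θ).subset fun d hd => right_ne_zero_of_mul hd
    rw [← finsum_add_distrib (hfin θ) (hfin ψ)]
    simp [mul_add]
  map_smul' c θ := by
    rw [smul_eq_mul, ← smul_eq_mul, smul_finsum]
    simp [mul_left_comm]

theorem gaussian_apply (Z : V →L⋆[ℂ] V) (hZ : IsSymmetricAntilinear Z)
    (θ : SymmetricAlgebra ℂ V) : gaussian Z hZ θ =
      ∑ᶠ d : ℕ, ((d.factorial : ℕ) : ℂ)⁻¹ * symInner V θ (quadratic Z hZ ^ d) := rfl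

end FockSpace

section DetSqrt

/-- Complex matrices `A` with `Re (v* A v) > 0` for all `v ≠ 0`. -/
def IsAccretiveMatrix {n : ℕ} (A : Matrix (Fin n) (Fin n) ℂ) : Prop :=
  ∀ v : Fin n → ℂ, v ≠ 0 → 0 < (star v ⬝ᵥ A.mulVec v).re

theorem IsAccretiveMatrix.det_ne_zero {n : ℕ} {A : Matrix (Fin n) (Fin n) ℂ}
    (hA : IsAccretiveMatrix A) : A.det ≠ 0 := by
  intro h
  obtain ⟨v, hv, hv'⟩ := Matrix.exists_mulVec_eq_zero_iff.2 h
  have := hA v hv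
  simp [hv'] at this

theorem IsAccretiveMatrix.submatrix_succ {n : ℕ} {A : Matrix (Fin (n + 1)) (Fin (n + 1)) ℂ}
    (hA : IsAccretiveMatrix A) : IsAccretiveMatrix (A.submatrix Fin.succ Fin.succ) := by
  intro v hv
  have h := hA (Fin.cons 0 v) (by
    intro h
    apply hv
    funext i
    simpa using congrFun h i.succ)
  have e : (star (Fin.cons 0 v : Fin (n + 1) → ℂ) ⬝ᵥ A.mulVec (Fin.cons 0 v)) =
      star v ⬝ᵥ (A.submatrix Fin.succ Fin.succ).mulVec v := by
    simp [dotProduct, Matrix.mulVec, Fin.sum_univ_succ]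
  rwa [e] at h

theorem IsAccretiveMatrix.re_pivot_pos {n : ℕ} {A : Matrix (Fin (n + 1)) (Fin (n + 1)) ℂ}
    (hA : IsAccretiveMatrix A) :
    0 < (A.det / (A.submatrix Fin.succ Fin.succ).det).re := by
  have h0 := hA.submatrix_succ.det_ne_zero
  set w : Fin (n + 1) → ℂ := A.adjugate.mulVec (Pi.single 0 1) with hw
  have hw0 : w 0 = (A.submatrix Fin.succ Fin.succ).det := by
    rw [hw, Matrix.mulVec_single_one]
    simp [Matrix.col, Matrix.adjugate_fin_succ_eq_det_submatrix]
  have hAw : A.mulVec w = A.det • (Pi.single 0 1 : Fin (n + 1) → ℂ) := by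
    rw [hw, Matrix.mulVec_mulVec, Matrix.mul_adjugate, Matrix.smul_mulVec, Matrix.one_mulVec]
  have hpos := hA w (fun h => h0 (by rw [← hw0, h]; rfl))
  rw [hAw, dotProduct_smul, dotProduct_single_one, Pi.star_apply, hw0] at hpos
  set a := A.det
  set b := (A.submatrix Fin.succ Fin.succ).det
  have hb : 0 < Complex.normSq b := Complex.normSq_pos.2 h0
  rw [Complex.div_re, ← add_div]
  apply div_pos _ hb
  simpa using hpos

/-- The determinant has a holomorphic square root on accretive matrices, namely the product of the
principal square roots of the pivots. -/
theorem exists_matrix_detSqrt (E : Type*) [NormedAddCommGroup E] [NormedSpace ℂ E] (n : ℕ) :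
    ∃ F : Matrix (Fin n) (Fin n) ℂ → ℂ,
      (∀ A, IsAccretiveMatrix A → F A ^ 2 = A.det) ∧ F 1 = 1 ∧
      ∀ (s : Set E) (A : E → Matrix (Fin n) (Fin n) ℂ),
        (∀ i j, DifferentiableOn ℂ (fun t => A t i j) s) →
        (∀ t ∈ s, IsAccretiveMatrix (A t)) → DifferentiableOn ℂ (fun t => F (A t)) s := by
  induction n with
  | zero =>
    exact ⟨fun _ => 1, fun A _ => by simp, rfl, fun s A _ _ => differentiableOn_const _⟩
  | succ n ih =>
    obtain ⟨F, hF, hF1, hFd⟩ := ih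
    refine ⟨fun A => (A.det / (A.submatrix Fin.succ Fin.succ).det) ^ (((2 : ℕ) : ℂ)⁻¹) *
      F (A.submatrix Fin.succ Fin.succ), ?_, ?_, ?_⟩
    · intro A hA
      rw [mul_pow, hF _ hA.submatrix_succ, Complex.cpow_nat_inv_pow _ two_ne_zero,
        div_mul_cancel₀ _ hA.submatrix_succ.det_ne_zero]
    · have : ((1 : Matrix (Fin (n + 1)) (Fin (n + 1)) ℂ).submatrix Fin.succ Fin.succ) = 1 :=
        Matrix.submatrix_one _ (Fin.succ_injective _)
      simp [this, hF1]
    · intro s A hd hA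
      have hdet : ∀ (m : ℕ) (M : E → Matrix (Fin m) (Fin m) ℂ),
          (∀ i j, DifferentiableOn ℂ (fun t => M t i j) s) →
          DifferentiableOn ℂ (fun t => (M t).det) s := by
        intro m M hM
        simp only [Matrix.det_apply]
        refine DifferentiableOn.fun_sum fun σ _ => ?_
        refine DifferentiableOn.fun_const_smul ?_ _
        have hprod : ∀ u : Finset (Fin m),
            DifferentiableOn ℂ (fun t => ∏ i ∈ u, M t (σ i) i) s := by
          intro u
          induction u using Finset.induction_on with
          | empty => simp
          | insert a u ha ih => simpa [Finset.prod_insert ha] using (hM _ _).fun_mul ih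
        exact hprod _
      refine DifferentiableOn.mul ?_ (hFd s _ (fun i j => hd _ _) fun t ht => (hA t ht).submatrix_succ)
      refine DifferentiableOn.cpow ?_ (differentiableOn_const _) ?_
      · simp only [div_eq_mul_inv]
        exact (hdet _ A hd).fun_mul
          ((hdet _ (fun t => (A t).submatrix Fin.succ Fin.succ) fun i j => hd _ _).fun_inv
            fun t ht => (hA t ht).submatrix_succ.det_ne_zero)
      · intro t ht
        exact Or.inl (hA t ht).re_pivot_pos

variable (V : Type*) [NormedAddCommGroup V] [InnerProductSpace ℂ V]

/-- The set `𝒢(V)` of complex-linear maps `T` with `Re ⟨v | T v⟩ > 0` for all `v ≠ 0`. -/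
def accretive : Set (V →L[ℂ] V) := {T | ∀ v : V, v ≠ 0 → 0 < (⟪v, T v⟫_ℂ).re}

variable [FiniteDimensional ℂ V]

theorem exists_detSqrt : ∃ f : (V →L[ℂ] V) → ℂ,
    DifferentiableOn ℂ f (accretive V) ∧ (∀ T ∈ accretive V, f T ^ 2 = T.det) ∧ f 1 = 1 := by
  obtain ⟨F, hF, hF1, hFd⟩ := exists_matrix_detSqrt (V →L[ℂ] V) (Module.finrank ℂ V)
  set b := stdOrthonormalBasis ℂ V with hb
  have hent : ∀ (T : V →L[ℂ] V) i j,
      LinearMap.toMatrix b.toBasis b.toBasis (T : V →ₗ[ℂ] V) i j = ⟪b i, T (b j)⟫_ℂ := by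
    intro T i j
    simp [LinearMap.toMatrix_apply, OrthonormalBasis.repr_apply_apply]
  have hacc : ∀ T ∈ accretive V,
      IsAccretiveMatrix (LinearMap.toMatrix b.toBasis b.toBasis (T : V →ₗ[ℂ] V)) := by
    intro T hT v hv
    have hne : ∑ i, v i • b i ≠ 0 := by
      intro h
      apply hv
      funext i
      exact Fintype.linearIndependent_iff.1 b.toBasis.linearIndependent v (by simpa using h) i
    have h := hT _ hne
    have e : ⟪∑ i, v i • b i, T (∑ i, v i • b i)⟫_ℂ =
        star v ⬝ᵥ (LinearMap.toMatrix b.toBasis b.toBasis (T : V →ₗ[ℂ] V)).mulVec v := by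
      simp only [map_sum, map_smul, sum_inner, inner_sum, inner_smul_left, inner_smul_right,
        dotProduct, Matrix.mulVec, hent, Finset.mul_sum, Pi.star_apply]
      rw [Finset.sum_comm]
      refine Finset.sum_congr rfl fun i _ => Finset.sum_congr rfl fun j _ => ?_
      simp only [RCLike.star_def]
      ring
    rwa [e] at h
  refine ⟨fun T => F (LinearMap.toMatrix b.toBasis b.toBasis (T : V →ₗ[ℂ] V)), ?_, ?_, ?_⟩
  · refine hFd _ (fun T => LinearMap.toMatrix b.toBasis b.toBasis (T : V →ₗ[ℂ] V)) ?_ hacc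
    intro i j
    simp only [hent]
    have : (fun T : V →L[ℂ] V => ⟪b i, T (b j)⟫_ℂ) =
        fun T => ((innerSL ℂ (b i)).comp (ContinuousLinearMap.apply ℂ V (b j))) T := by
      funext T; simp
    rw [this]
    exact ContinuousLinearMap.differentiableOn _
  · intro T hT
    change F _ ^ 2 = _
    rw [hF _ (hacc T hT), LinearMap.det_toMatrix]
  · change F _ = 1
    rw [ContinuousLinearMap.toLinearMap_one, LinearMap.toMatrix_one, hF1]

/-- `Det^{1/2}`: the holomorphic square root of the determinant on `accretive V` that takes the
value `1` at the identity. -/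
noncomputable def detSqrt : (V →L[ℂ] V) → ℂ := (exists_detSqrt V).choose

theorem detSqrt_spec : DifferentiableOn ℂ (detSqrt V) (accretive V) ∧
    (∀ T ∈ accretive V, detSqrt V T ^ 2 = T.det) ∧ detSqrt V 1 = 1 :=
  (exists_detSqrt V).choose_spec

/-- The defining properties determine `detSqrt` on `accretive V`. -/
theorem detSqrt_unique (f : (V →L[ℂ] V) → ℂ) (hf : DifferentiableOn ℂ f (accretive V))
    (hf2 : ∀ T ∈ accretive V, f T ^ 2 = T.det) (hf1 : f 1 = 1) :
    Set.EqOn f (detSqrt V) (accretive V) := by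
  obtain ⟨h1, h2, h3⟩ := detSqrt_spec V
  have hconv : Convex ℝ (accretive V) := by
    intro S hS T hT a b ha hb hab v hv
    have e : (⟪v, (a • S + b • T) v⟫_ℂ).re = a * (⟪v, S v⟫_ℂ).re + b * (⟪v, T v⟫_ℂ).re := by
      simp [inner_smul_right_eq_smul]
    rw [e]
    have hs := hS v hv
    have ht := hT v hv
    rcases ha.eq_or_lt with rfl | ha
    · have : b = 1 := by linarith
      subst this; linarith
    · have := mul_pos ha hs
      have := mul_nonneg hb ht.le
      linarith
  have hone : (1 : V →L[ℂ] V) ∈ accretive V := by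
    intro v hv
    have : 0 < ‖v‖ ^ 2 := by positivity
    simpa [inner_self_eq_norm_sq_to_K, ← Complex.ofReal_pow] using this
  refine hconv.isPreconnected.eq_of_sq_eq hf.continuousOn h1.continuousOn ?_ ?_ hone
    (hf1.trans h3.symm)
  · intro T hT
    simp [hf2 T hT, h2 T hT]
  · intro T hT h0
    have hdet : LinearMap.det (T : V →ₗ[ℂ] V) = 0 := by
      have := h2 T hT
      rw [h0] at this
      simpa using this.symm
    obtain ⟨v, hv, hv0⟩ := (Submodule.ne_bot_iff _).1
      (bot_lt_iff_ne_bot.1 (LinearMap.bot_lt_ker_of_det_eq_zero hdet))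
    have hTv : T v = 0 := hv
    have := hT v hv0
    simp [hTv] at this

end DetSqrt

end BosonicFock

/-!
Write `G X d` for the component `ζ ^ d / d!` of the Gaussian `e^X`. Annihilation by `x`, the adjoint
of multiplication by `x`, takes `G X (d + 1)` to `X x * G X d`. Hence moving `x` across the pairing
`⟨G X (m + 1) | x w G Y m⟩` turns it into `X x`, and moving `X x` back either contracts it with
`w` or replaces it by `Y X x` one degree lower; iterating gives a sum of the numbers
`⟨X (Y X)^j x | w⟩`. Summing over an orthonormal basis, the numbers `c m = ⟨G X m | G Y m⟩` satisfy
`(m + 1) c (m + 1) = ½ ∑_{j + k = m} tr ((Y X)^(j + 1)) c k`. By Jacobi's formula this is also the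
recursion for the Taylor coefficients at `0` of `z ↦ Det^{1/2} (1 - z Y X)⁻¹`, which is holomorphic
for `|z| < ‖Y X‖⁻¹`, so `∑ c m` converges to its value at `z = 1`. The case `X = Y` says that
the mutually orthogonal components of `e^X` are square summable.
-/

namespace BosonicFock

open SymmetricAlgebra (ι)
open Finset.HasAntidiagonal (antidiagonal)
open scoped Nat ContDiff Topology

section Calculus

variable {𝕜 : Type*} [NontriviallyNormedField 𝕜]

theorem trace_adjugate_mul {n R : Type*} [Fintype n] [DecidableEq n] [CommRing R]
    (A B : Matrix n n R) : (A.adjugate * B).trace = ∑ i, (A.updateRow i (B i)).det := by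
  simp only [← Matrix.cramer_transpose_apply, Matrix.cramer_eq_adjugate_mulVec,
    ← Matrix.adjugate_transpose, Matrix.mulVec, dotProduct, Matrix.transpose_apply]
  rw [Matrix.trace_mul_comm]
  simp only [Matrix.trace, Matrix.diag, Matrix.mul_apply, mul_comm]

theorem hasDerivAt_matrix_det {n : Type*} [Fintype n] [DecidableEq n] {A : 𝕜 → Matrix n n 𝕜}
    {A' : Matrix n n 𝕜} {z : 𝕜} (hA : ∀ i, HasDerivAt (fun w => A w i) (A' i) z) :
    HasDerivAt (fun w => (A w).det) ((A z).adjugate * A').trace z := by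
  let D : ContinuousMultilinearMap 𝕜 (fun _ : n => n → 𝕜) 𝕜 :=
    ⟨Matrix.detRowAlternating.toMultilinearMap, continuous_id.matrix_det⟩
  have hD := (HasFDerivAt.multilinear_comp D fun i => (hA i).hasFDerivAt).hasDerivAt
  have hrow (i) : D (Function.update (A z) i (A' i)) = ((A z).updateRow i (A' i)).det := rfl
  exact hD.congr_deriv (by simp [trace_adjugate_mul, ← hrow])

theorem hasDerivAt_det [CompleteSpace 𝕜] {V : Type*} [NormedAddCommGroup V] [NormedSpace 𝕜 V]
    [FiniteDimensional 𝕜 V] {A : 𝕜 → V →L[𝕜] V} {A' : V →L[𝕜] V} {z : 𝕜}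
    (hA : HasDerivAt A A' z) (hz : IsUnit (A z)) :
    HasDerivAt (fun w => (A w).det)
      ((A z).det * LinearMap.trace 𝕜 V (Ring.inverse (A z) * A').toLinearMap) z := by
  set b := Module.finBasis 𝕜 V
  let M (T : V →L[𝕜] V) := LinearMap.toMatrix b b T.toLinearMap
  have det_M (T) : (M T).det = T.det := LinearMap.det_toMatrix b _
  have M_mul (S T) : M (S * T) = M S * M T := LinearMap.toMatrix_mul b _ _
  have hM : HasDerivAt (fun w => (M (A w)).det) ((M (A z)).adjugate * M A').trace z := by
    refine hasDerivAt_matrix_det fun i => hasDerivAt_pi.2 fun j => ?_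
    let entry : (V →L[𝕜] V) →L[𝕜] 𝕜 := LinearMap.toContinuousLinearMap
      (Matrix.entryLinearMap 𝕜 𝕜 i j ∘ₗ (LinearMap.toMatrix b b).toLinearMap ∘ₗ
        ContinuousLinearMap.coeLM 𝕜)
    exact entry.hasFDerivAt.comp_hasDerivAt z hA
  have hadj : (M (A z)).adjugate = (A z).det • M (Ring.inverse (A z)) := by
    rw [← det_M, ← mul_one (M (A z)).adjugate, ← LinearMap.toMatrix_one b]
    change _ * M 1 = _
    rw [← Ring.mul_inverse_cancel _ hz, M_mul, ← mul_assoc, Matrix.adjugate_mul, smul_mul_assoc,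
      one_mul]
  simp only [det_M, hadj, smul_mul_assoc, ← M_mul, Matrix.trace_smul, smul_eq_mul] at hM
  rwa [LinearMap.trace_eq_matrix_trace 𝕜 b]

theorem iteratedDeriv_eq_factorial_mul_of_deriv_eq_mul {f g : 𝕜 → 𝕜} {z : 𝕜} {a c : ℕ → 𝕜}
    (hf : ContDiffAt 𝕜 ∞ f z) (hg : ContDiffAt 𝕜 ∞ g z)
    (hderiv : deriv f =ᶠ[𝓝 z] fun w => g w * f w) (ha : ∀ k, iteratedDeriv k g z = k ! * a k)
    (hc₀ : f z = c 0) (hc : ∀ m : ℕ, (m + 1) * c (m + 1) = ∑ p ∈ antidiagonal m, a p.1 * c p.2)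
    (m : ℕ) : iteratedDeriv m f z = m ! * c m := by
  induction m using Nat.strong_induction_on with
  | _ m ih =>
    cases m with
    | zero => simp [hc₀]
    | succ m =>
      rw [iteratedDeriv_succ', hderiv.iteratedDeriv_eq, iteratedDeriv_fun_mul
        (hg.of_le (mod_cast le_top)) (hf.of_le (mod_cast le_top)), Nat.factorial_succ, Nat.cast_mul,
        mul_right_comm, Nat.cast_succ, hc,
        Finset.Nat.sum_antidiagonal_eq_sum_range_succ fun i j => a i * c j, Finset.sum_mul]
      refine Finset.sum_congr rfl fun k hk => ?_
      have hk' : k ≤ m := Nat.lt_succ_iff.1 (Finset.mem_range.1 hk)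
      rw [ha, ih (m - k) (by lia), ← Nat.choose_mul_factorial_mul_factorial hk']
      push_cast
      ring

variable {A F : Type*} [NormedRing A] [NormedAlgebra 𝕜 A] [HasSummableGeomSeries A]
  [NormedAddCommGroup F] [NormedSpace 𝕜 F]

theorem analyticAt_comp_inverse_one_sub_smul (τ : A →L[𝕜] F) (a : A) :
    AnalyticAt 𝕜 (fun w : 𝕜 => τ (Ring.inverse (1 - w • a))) 0 :=
  (τ.comp_hasFPowerSeriesOnBall
    (spectrum.hasFPowerSeriesOnBall_inverse_one_sub_smul 𝕜 a)).analyticAt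

theorem iteratedDeriv_comp_inverse_one_sub_smul [CompleteSpace F] (τ : A →L[𝕜] F) (a : A) (k : ℕ) :
    iteratedDeriv k (fun w : 𝕜 => τ (Ring.inverse (1 - w • a))) 0 = k ! • τ (a ^ k) := by
  have h := (τ.comp_hasFPowerSeriesOnBall
    (spectrum.hasFPowerSeriesOnBall_inverse_one_sub_smul 𝕜 a)).factorial_smul 1 k
  rw [iteratedDeriv_eq_iteratedFDeriv]
  refine h.symm.trans (congrArg (k ! • ·) ?_)
  change τ (ContinuousMultilinearMap.mkPiRing 𝕜 (Fin k) (a ^ k) fun _ => 1) = τ (a ^ k)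
  rw [ContinuousMultilinearMap.mkPiRing_apply, Finset.prod_const_one, one_smul]

end Calculus

section DetSqrt

variable {V : Type*} [NormedAddCommGroup V] [InnerProductSpace ℂ V]

theorem one_sub_mem_accretive {T : V →L[ℂ] V} (hT : ‖T‖ < 1) : 1 - T ∈ accretive V := by
  intro v hv
  have hv' : 0 < ‖v‖ := norm_pos_iff.2 hv
  have hre : (⟪v, T v⟫_ℂ).re < ‖v‖ * ‖v‖ :=
    calc (⟪v, T v⟫_ℂ).re ≤ ‖v‖ * ‖T v‖ := re_inner_le_norm (𝕜 := ℂ) v (T v)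
      _ ≤ ‖v‖ * (‖T‖ * ‖v‖) := by gcongr; exact T.le_opNorm v
      _ < ‖v‖ * ‖v‖ := by gcongr; exact mul_lt_of_lt_one_left hv' hT
  simpa [inner_self_eq_norm_sq_to_K, ← Complex.ofReal_pow, sq] using hre

theorem norm_comp_lt_one {X Y : V →L⋆[ℂ] V} (hX : ‖X‖ < 1) (hY : ‖Y‖ < 1) :
    ‖(Y.comp X : V →L[ℂ] V)‖ < 1 :=
  (ContinuousLinearMap.opNorm_comp_le Y X).trans_lt
    (mul_lt_one_of_nonneg_of_lt_one_left (norm_nonneg _) hY hX.le)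

variable [FiniteDimensional ℂ V]

theorem isUnit_of_mem_accretive {T : V →L[ℂ] V} (hT : T ∈ accretive V) : IsUnit T := by
  have hinj : Function.Injective T := (injective_iff_map_eq_zero T).2 fun v hv => by
    by_contra hv0
    simpa [hv] using hT v hv0
  exact ContinuousLinearMap.isUnit_iff_bijective.2
    ⟨hinj, LinearMap.injective_iff_surjective.1 hinj⟩

theorem detSqrt_ne_zero_of_mem_accretive {T : V →L[ℂ] V} (hT : T ∈ accretive V) :
    detSqrt V T ≠ 0 := by
  have hdet : T.det ≠ 0 := (LinearMap.isUnit_det _ ((isUnit_of_mem_accretive hT).map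
    (ContinuousLinearMap.toLinearMapRingHom : (V →L[ℂ] V) →+* V →ₗ[ℂ] V))).ne_zero
  rw [← (detSqrt_spec V).2.1 T hT] at hdet
  exact ne_zero_pow two_ne_zero hdet

theorem hasDerivAt_inv_detSqrt {A : ℂ → V →L[ℂ] V} {A' : V →L[ℂ] V} {z : ℂ}
    (hA : HasDerivAt A A' z) (hacc : ∀ᶠ w in 𝓝 z, A w ∈ accretive V) :
    HasDerivAt (fun w => (detSqrt V (A w))⁻¹)
      (-(2⁻¹ * LinearMap.trace ℂ V (Ring.inverse (A z) * A').toLinearMap) * (detSqrt V (A z))⁻¹)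
      z := by
  have hz := hacc.self_of_nhds
  have hne := detSqrt_ne_zero_of_mem_accretive hz
  have hsqrt : DifferentiableAt ℂ (fun w => detSqrt V (A w)) z :=
    (((detSqrt_spec V).1 _ hz).comp z hA.differentiableAt.differentiableWithinAt
      (Set.mapsTo_preimage A _)).differentiableAt hacc
  have hsq : (fun w => detSqrt V (A w) ^ 2) =ᶠ[𝓝 z] fun w => (A w).det :=
    hacc.mono fun w hw => (detSqrt_spec V).2.1 _ hw
  have hderiv := (hsqrt.hasDerivAt.pow 2).unique
    ((hasDerivAt_det hA (isUnit_of_mem_accretive hz)).congr_of_eventuallyEq hsq)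
  rw [← hsq.eq_of_nhds] at hderiv
  refine (hsqrt.hasDerivAt.fun_inv hne).congr_deriv ?_
  field_simp
  simp only [Nat.cast_ofNat, Nat.add_one_sub_one, pow_one] at hderiv
  apply mul_left_cancel₀ hne
  linear_combination -hderiv

theorem hasDerivAt_inv_detSqrt_one_sub_smul (T : V →L[ℂ] V) {z : ℂ} (hz : ‖z • T‖ < 1) :
    HasDerivAt (fun w : ℂ => (detSqrt V (1 - w • T))⁻¹)
      (2⁻¹ * LinearMap.trace ℂ V (Ring.inverse (1 - z • T) * T).toLinearMap *
        (detSqrt V (1 - z • T))⁻¹) z := by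
  have hpath : HasDerivAt (fun w : ℂ => 1 - w • T) (-T) z := by
    simpa using ((hasDerivAt_id z).smul_const T).const_sub 1
  have hopen : IsOpen {w : ℂ | ‖w • T‖ < 1} := isOpen_lt (by fun_prop) continuous_const
  have hacc : ∀ᶠ w : ℂ in 𝓝 z, 1 - w • T ∈ accretive V :=
    (hopen.eventually_mem hz).mono fun w hw => one_sub_mem_accretive hw
  simpa using hasDerivAt_inv_detSqrt hpath hacc

theorem iteratedDeriv_inv_detSqrt_one_sub_smul (T : V →L[ℂ] V) {c : ℕ → ℂ} (hc₀ : c 0 = 1)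
    (hc : ∀ m : ℕ, (m + 1) * c (m + 1) = 2⁻¹ * ∑ p ∈ antidiagonal m,
      LinearMap.trace ℂ V (T ^ (p.1 + 1) : V →L[ℂ] V).toLinearMap * c p.2) (m : ℕ) :
    iteratedDeriv m (fun w : ℂ => (detSqrt V (1 - w • T))⁻¹) 0 = m ! * c m := by
  let τ : (V →L[ℂ] V) →L[ℂ] ℂ := LinearMap.toContinuousLinearMap
    ((2⁻¹ : ℂ) • LinearMap.trace ℂ V ∘ₗ ContinuousLinearMap.coeLM ℂ ∘ₗ LinearMap.mulRight ℂ T)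
  have τ_apply (S : V →L[ℂ] V) : τ S = 2⁻¹ * LinearMap.trace ℂ V (S * T).toLinearMap := rfl
  have hopen : IsOpen {w : ℂ | ‖w • T‖ < 1} := isOpen_lt (by fun_prop) continuous_const
  have hnhds : {w : ℂ | ‖w • T‖ < 1} ∈ 𝓝 0 := hopen.mem_nhds (by simp)
  have hdiff : DifferentiableOn ℂ (fun w : ℂ => (detSqrt V (1 - w • T))⁻¹) {w | ‖w • T‖ < 1} :=
    fun w hw => (hasDerivAt_inv_detSqrt_one_sub_smul T hw).differentiableAt.differentiableWithinAt
  refine iteratedDeriv_eq_factorial_mul_of_deriv_eq_mul (a := fun k => τ (T ^ k))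
    (hdiff.analyticAt hnhds).contDiffAt (analyticAt_comp_inverse_one_sub_smul τ T).contDiffAt
    ?_ (fun k => ?_) ?_ (fun m => ?_) m
  · filter_upwards [hnhds] with w hw
    rw [(hasDerivAt_inv_detSqrt_one_sub_smul T hw).deriv, τ_apply]
  · rw [iteratedDeriv_comp_inverse_one_sub_smul, nsmul_eq_mul]
  · simp [hc₀, (detSqrt_spec V).2.2]
  · simp only [hc, τ_apply, Finset.mul_sum, mul_assoc, pow_succ]

theorem hasSum_inv_detSqrt_one_sub {T : V →L[ℂ] V} (hT : ‖T‖ < 1) {c : ℕ → ℂ} (hc₀ : c 0 = 1)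
    (hc : ∀ m : ℕ, (m + 1) * c (m + 1) = 2⁻¹ * ∑ p ∈ antidiagonal m,
      LinearMap.trace ℂ V (T ^ (p.1 + 1) : V →L[ℂ] V).toLinearMap * c p.2) :
    HasSum c (detSqrt V (1 - T))⁻¹ := by
  have enorm_lt_one (S : V →L[ℂ] V) : ‖S‖ₑ < 1 ↔ ‖S‖ < 1 := by
    rw [← ENNReal.coe_one, enorm_lt_coe]; rfl
  have hdiff : DifferentiableOn ℂ (fun w : ℂ => (detSqrt V (1 - w • T))⁻¹)
      (Metric.eball 0 ‖T‖ₑ⁻¹) := fun w hw => by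
    rw [Metric.mem_eball, edist_zero_right, ← one_div] at hw
    have hwT : ‖w • T‖ₑ < 1 := by rw [enorm_smul]; exact ENNReal.mul_lt_of_lt_div hw
    exact (hasDerivAt_inv_detSqrt_one_sub_smul T
      ((enorm_lt_one _).1 hwT)).differentiableAt.differentiableWithinAt
  have hone : (1 : ℂ) ∈ Metric.eball 0 ‖T‖ₑ⁻¹ := by
    simpa [Metric.mem_eball, edist_zero_right, enorm_lt_one] using hT
  simpa [iteratedDeriv_inv_detSqrt_one_sub_smul T hc₀ hc, Nat.factorial_ne_zero] using
    Complex.hasSum_taylorSeries_on_eball hdiff hone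

end DetSqrt

section Annihilation

variable {V : Type*} [NormedAddCommGroup V] [InnerProductSpace ℂ V] [FiniteDimensional ℂ V]

/-- The annihilation operator of `x`: the derivation of `SV` with `y ↦ ⟨x | y⟩` on `V`, carried over
from `polyAnn x` along `toPoly`. It is the adjoint of multiplication by `x`. -/
noncomputable def ann (x : V) :
    Derivation ℂ (SymmetricAlgebra ℂ V) (SymmetricAlgebra ℂ V) :=
  Derivation.mk' (toPoly.symm.toLinearMap ∘ₗ (polyAnn x).toLinearMap ∘ₗ toPoly.toLinearMap)
    fun θ ψ => by simp [map_add]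

theorem ann_apply (x : V) (θ : SymmetricAlgebra ℂ V) :
    ann x θ = toPoly.symm (polyAnn x (toPoly θ)) := rfl

theorem ann_ι (x y : V) : ann x (ι ℂ V y) = algebraMap ℂ _ ⟪x, y⟫_ℂ := by
  rw [ann_apply, polyAnn_ι, ← MvPolynomial.algebraMap_eq, AlgEquiv.commutes]

theorem ann_ι_mul (x y : V) (θ : SymmetricAlgebra ℂ V) :
    ann x (ι ℂ V y * θ) = ⟪x, y⟫_ℂ • θ + ι ℂ V y * ann x θ := by
  rw [Derivation.leibniz, ann_ι, smul_eq_mul, smul_eq_mul, mul_comm θ, ← Algebra.smul_def, add_comm]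

theorem symInner_ι_mul_left (x : V) (θ ψ : SymmetricAlgebra ℂ V) :
    symInner V (ι ℂ V x * θ) ψ = symInner V θ (ann x ψ) := by
  rw [symInner_eq_coordInner, coordInner_ι_mul, coordInner_apply, ann_apply,
    AlgEquiv.apply_symm_apply]

theorem symInner_ι_mul_right (x : V) (θ ψ : SymmetricAlgebra ℂ V) :
    symInner V θ (ι ℂ V x * ψ) = symInner V (ann x θ) ψ := by
  rw [← symInner_conj, symInner_ι_mul_left, symInner_conj]

theorem symInner_one_one : symInner V 1 1 = 1 := by
  simpa using symInner_prod (V := V) (d := 0) Fin.elim0 Fin.elim0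

theorem symInner_ι_ι (x y : V) : symInner V (ι ℂ V x) (ι ℂ V y) = ⟪x, y⟫_ℂ := by
  simpa using symInner_prod ![x] ![y]

end Annihilation

section Quadratic

variable {V κ : Type*} [NormedAddCommGroup V] [InnerProductSpace ℂ V] [Fintype κ]

theorem sum_inner_smul_map (b : OrthonormalBasis κ ℂ V) (Z : V →L⋆[ℂ] V) (x : V) :
    ∑ k, ⟪x, b k⟫_ℂ • Z (b k) = Z x := by
  conv_rhs => rw [← b.sum_repr' x, map_sum]
  exact Finset.sum_congr rfl fun k _ => by rw [map_smulₛₗ, inner_conj_symm]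

variable [FiniteDimensional ℂ V]

theorem ann_half_sum_ι_mul_ι (b : OrthonormalBasis κ ℂ V) {Z : V →L⋆[ℂ] V}
    (hZ : IsSymmetricAntilinear Z) (x : V) :
    ann x ((2⁻¹ : ℂ) • ∑ k, ι ℂ V (b k) * ι ℂ V (Z (b k))) = ι ℂ V (Z x) := by
  have coord : ∑ k, ⟪x, Z (b k)⟫_ℂ • b k = Z x := by
    simp_rw [hZ (b _) x, b.sum_repr']
  rw [Derivation.map_smul, map_sum]
  simp only [ann_ι_mul, ann_ι, mul_comm _ (algebraMap ℂ _ _), ← Algebra.smul_def,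
    Finset.sum_add_distrib, ← map_smul, ← map_sum, coord, sum_inner_smul_map]
  rw [← two_smul ℂ, inv_smul_smul₀ two_ne_zero]

theorem quadratic_eq_sum (b : OrthonormalBasis κ ℂ V) {Z : V →L⋆[ℂ] V}
    (hZ : IsSymmetricAntilinear Z) :
    quadratic Z hZ = (2⁻¹ : ℂ) • ∑ k, ι ℂ V (b k) * ι ℂ V (Z (b k)) := by
  refine (existsUnique_quadratic hZ).unique (existsUnique_quadratic hZ).choose_spec.1
    ⟨?_, fun x y => ?_⟩
  · rw [symPower, pow_two]
    exact Submodule.smul_mem _ _ (Submodule.sum_mem _ fun k _ =>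
      Submodule.mul_mem_mul ⟨_, rfl⟩ ⟨_, rfl⟩)
  · rw [symInner_ι_mul_left, ann_half_sum_ι_mul_ι b hZ, symInner_ι_ι]

theorem ann_quadratic {Z : V →L⋆[ℂ] V} (hZ : IsSymmetricAntilinear Z) (x : V) :
    ann x (quadratic Z hZ) = ι ℂ V (Z x) := by
  rw [quadratic_eq_sum (stdOrthonormalBasis ℂ V), ann_half_sum_ι_mul_ι _ hZ]

end Quadratic

section GaussianTerm

variable {V : Type*} [NormedAddCommGroup V] [InnerProductSpace ℂ V] [FiniteDimensional ℂ V]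

/-- The component `ζ ^ d / d!`, of degree `2 * d`, of the Gaussian of `Z`. -/
noncomputable def gaussianTerm (Z : V →L⋆[ℂ] V) (hZ : IsSymmetricAntilinear Z) (d : ℕ) :
    SymmetricAlgebra ℂ V :=
  (d.factorial : ℂ)⁻¹ • quadratic Z hZ ^ d

variable {X Y Z : V →L⋆[ℂ] V} (hX : IsSymmetricAntilinear X) (hY : IsSymmetricAntilinear Y)
  (hZ : IsSymmetricAntilinear Z)

theorem gaussianTerm_zero : gaussianTerm Z hZ 0 = 1 := by
  simp [gaussianTerm]

theorem gaussianTerm_mem_symPower (d : ℕ) : gaussianTerm Z hZ d ∈ symPower V (2 * d) := by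
  rw [symPower, pow_mul]
  exact Submodule.smul_mem _ _ (Submodule.pow_mem_pow _ (quadratic_mem Z hZ) d)

theorem quadratic_mul_gaussianTerm (d : ℕ) :
    quadratic Z hZ * gaussianTerm Z hZ d = (d + 1 : ℂ) • gaussianTerm Z hZ (d + 1) := by
  have hd : (d + 1 : ℂ) ≠ 0 := d.cast_add_one_ne_zero
  rw [gaussianTerm, gaussianTerm, mul_smul_comm, ← pow_succ', smul_smul, Nat.factorial_succ,
    Nat.cast_mul, Nat.cast_succ, mul_inv, mul_inv_cancel_left₀ hd]

theorem ann_gaussianTerm_succ (x : V) (d : ℕ) :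
    ann x (gaussianTerm Z hZ (d + 1)) = ι ℂ V (Z x) * gaussianTerm Z hZ d := by
  have hd : (d + 1 : ℂ) ≠ 0 := d.cast_add_one_ne_zero
  rw [gaussianTerm, gaussianTerm, Derivation.map_smul, Derivation.leibniz_pow, ann_quadratic,
    Nat.add_sub_cancel, smul_eq_mul, mul_smul_comm, mul_comm (_ ^ d), ← Nat.cast_smul_eq_nsmul ℂ,
    smul_smul, Nat.factorial_succ, Nat.cast_mul, Nat.cast_succ, mul_comm (d + 1 : ℂ), mul_inv,
    inv_mul_cancel_right₀ hd]

theorem symInner_gaussianTerm_ι_mul_ι_mul (x w : V) (m : ℕ) :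
    symInner V (gaussianTerm X hX (m + 1)) (ι ℂ V x * (ι ℂ V w * gaussianTerm Y hY m)) =
      ∑ p ∈ antidiagonal m, ⟪X (((Y.comp X : V →L[ℂ] V) ^ p.1) x), w⟫_ℂ *
        symInner V (gaussianTerm X hX p.2) (gaussianTerm Y hY p.2) := by
  induction m generalizing x with
  | zero =>
    simp [symInner_ι_mul_right, ann_gaussianTerm_succ, gaussianTerm_zero, symInner_ι_ι,
      symInner_one_one]
  | succ m ih =>
    rw [symInner_ι_mul_right, ann_gaussianTerm_succ, symInner_ι_mul_left, ann_ι_mul,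
      ann_gaussianTerm_succ, mul_left_comm, map_add, map_smul, smul_eq_mul,
      ← ContinuousLinearMap.comp_apply, ih, Finset.Nat.antidiagonal_succ, Finset.sum_cons,
      Finset.sum_map]
    simp [pow_succ]

theorem symInner_gaussianTerm_succ (m : ℕ) :
    (m + 1) * symInner V (gaussianTerm X hX (m + 1)) (gaussianTerm Y hY (m + 1)) =
      2⁻¹ * ∑ p ∈ antidiagonal m,
        LinearMap.trace ℂ V ((Y.comp X : V →L[ℂ] V) ^ (p.1 + 1) : V →L[ℂ] V).toLinearMap *
          symInner V (gaussianTerm X hX p.2) (gaussianTerm Y hY p.2) := by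
  set b := stdOrthonormalBasis ℂ V
  have matrixCoeff (k j) : ⟪X (((Y.comp X : V →L[ℂ] V) ^ j) (b k)), Y (b k)⟫_ℂ =
      ⟪b k, ((Y.comp X : V →L[ℂ] V) ^ (j + 1)) (b k)⟫_ℂ := by
    rw [hY, pow_succ']; rfl
  calc (m + 1) * symInner V (gaussianTerm X hX (m + 1)) (gaussianTerm Y hY (m + 1))
      = symInner V (gaussianTerm X hX (m + 1)) (quadratic Y hY * gaussianTerm Y hY m) := by
        rw [quadratic_mul_gaussianTerm, map_smul, smul_eq_mul]
    _ = 2⁻¹ * ∑ k, ∑ p ∈ antidiagonal m,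
          ⟪b k, ((Y.comp X : V →L[ℂ] V) ^ (p.1 + 1)) (b k)⟫_ℂ *
            symInner V (gaussianTerm X hX p.2) (gaussianTerm Y hY p.2) := by
        rw [quadratic_eq_sum b, smul_mul_assoc, map_smul, smul_eq_mul, Finset.sum_mul, map_sum]
        simp only [mul_assoc, symInner_gaussianTerm_ι_mul_ι_mul, matrixCoeff]
    _ = _ := by
        rw [Finset.sum_comm]
        simp only [← Finset.sum_mul, LinearMap.trace_eq_sum_inner _ b,
          ContinuousLinearMap.coe_coe]

end GaussianTerm

section Fock

variable {V : Type*} [NormedAddCommGroup V] [InnerProductSpace ℂ V] [FiniteDimensional ℂ V]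

theorem symInner_eq_zero_of_mem_symPower {d n : ℕ} (hdn : d ≠ n) {θ ψ : SymmetricAlgebra ℂ V}
    (hθ : θ ∈ symPower V d) (hψ : ψ ∈ symPower V n) : symInner V θ ψ = 0 := by
  have hspan := symPower_le_span d hθ
  clear hθ
  induction hspan using Submodule.span_induction with
  | mem θ hθ => obtain ⟨x, rfl⟩ := hθ; exact symInner_prod_symPower hdn x hψ
  | zero => simp
  | add θ₁ θ₂ _ _ h₁ h₂ => rw [map_add, LinearMap.add_apply, h₁, h₂, add_zero]
  | smul c θ _ h => rw [map_smulₛₗ, LinearMap.smul_apply, h, smul_zero]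

theorem orthogonalFamily_symPower :
    OrthogonalFamily ℂ (fun d => symPower V d) fun d =>
      (UniformSpace.Completion.toComplₗᵢ (𝕜 := ℂ)).comp (symPower V d).subtypeₗᵢ :=
  fun _ _ hdn θ ψ => (UniformSpace.Completion.inner_coe _ _).trans
    (symInner_eq_zero_of_mem_symPower hdn θ.2 ψ.2)

variable {X Y Z : V →L⋆[ℂ] V}

theorem hasSum_symInner_gaussianTerm (hX : X ∈ siegelDomain V) (hY : Y ∈ siegelDomain V) :
    HasSum (fun m => symInner V (gaussianTerm X hX.1 m) (gaussianTerm Y hY.1 m))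
      (detSqrt V (1 - Y.comp X))⁻¹ :=
  hasSum_inv_detSqrt_one_sub (norm_comp_lt_one hX.2 hY.2)
    (by rw [gaussianTerm_zero, gaussianTerm_zero, symInner_one_one])
    (symInner_gaussianTerm_succ hX.1 hY.1)

theorem summable_gaussianTerm (hZ : Z ∈ siegelDomain V) :
    Summable fun d => (gaussianTerm Z hZ.1 d : Fock V) := by
  have hsq (d) : ‖symInner V (gaussianTerm Z hZ.1 d) (gaussianTerm Z hZ.1 d)‖ =
      ‖gaussianTerm Z hZ.1 d‖ ^ 2 := by
    rw [← inner_eq_symInner, inner_self_eq_norm_sq_to_K, norm_pow, RCLike.norm_ofReal, abs_norm]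
  have hsum : Summable fun d => ‖gaussianTerm Z hZ.1 d‖ ^ 2 := by
    simpa only [hsq] using (hasSum_symInner_gaussianTerm hZ hZ).summable.norm
  have horth := (orthogonalFamily_symPower (V := V)).comp
    (γ := ℕ) (f := fun d => 2 * d) (mul_right_injective₀ two_ne_zero)
  exact (horth.summable_iff_norm_sq_summable
    fun d => (⟨_, gaussianTerm_mem_symPower hZ.1 d⟩ : symPower V (2 * d))).2 hsum

/-- The Gaussian of `Z` as a vector of Fock space; the series converges when `Z` lies in the Siegel
domain, and otherwise the value is the default one of `∑'`. -/
noncomputable def gaussianVector (Z : V →L⋆[ℂ] V) (hZ : IsSymmetricAntilinear Z) : Fock V :=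
  ∑' d, (gaussianTerm Z hZ d : Fock V)

theorem hasSum_gaussianVector (hZ : Z ∈ siegelDomain V) :
    HasSum (fun d => (gaussianTerm Z hZ.1 d : Fock V)) (gaussianVector Z hZ.1) :=
  (summable_gaussianTerm hZ).hasSum

theorem gaussian_eq_finsum (hZ : IsSymmetricAntilinear Z) (θ : SymmetricAlgebra ℂ V) :
    gaussian Z hZ θ = ∑ᶠ d : ℕ, symInner V θ (gaussianTerm Z hZ d) := by
  rw [gaussian_apply]
  exact finsum_congr fun d => by rw [gaussianTerm, map_smul, smul_eq_mul]

theorem gaussian_gaussianTerm (hX : IsSymmetricAntilinear X) (hY : IsSymmetricAntilinear Y)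
    (d : ℕ) :
    gaussian Y hY (gaussianTerm X hX d) =
      symInner V (gaussianTerm X hX d) (gaussianTerm Y hY d) := by
  rw [gaussian_eq_finsum]
  exact finsum_eq_single _ d fun n hn => symInner_eq_zero_of_mem_symPower (by lia)
    (gaussianTerm_mem_symPower hX d) (gaussianTerm_mem_symPower hY n)

theorem toAntidual_gaussianVector (hZ : Z ∈ siegelDomain V) :
    Fock.toAntidual V (gaussianVector Z hZ.1) = gaussian Z hZ.1 := by
  ext θ
  have hsum : HasSum (fun d => symInner V θ (gaussianTerm Z hZ.1 d))
      ⟪(θ : Fock V), gaussianVector Z hZ.1⟫_ℂ := by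
    simpa only [innerSL_apply_apply, UniformSpace.Completion.inner_coe, inner_eq_symInner] using
      (hasSum_gaussianVector hZ).mapL (innerSL ℂ (θ : Fock V))
  have hfin : (Function.support fun d => symInner V θ (gaussianTerm Z hZ.1 d)).Finite :=
    (finite_symInner_pow (quadratic_mem Z hZ.1) θ).subset fun d hd h => hd <| by
      simp only [gaussianTerm, map_smul, h, smul_zero]
  rw [Fock.toAntidual_apply, gaussian_eq_finsum, ← hsum.tsum_eq, tsum_eq_finsum hfin]

theorem inner_gaussianVector (hX : X ∈ siegelDomain V) (hY : Y ∈ siegelDomain V) :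
    ⟪gaussianVector X hX.1, gaussianVector Y hY.1⟫_ℂ = (detSqrt V (1 - Y.comp X))⁻¹ := by
  have hsum : HasSum (fun d => ⟪(gaussianTerm X hX.1 d : Fock V), gaussianVector Y hY.1⟫_ℂ)
      ⟪gaussianVector X hX.1, gaussianVector Y hY.1⟫_ℂ :=
    (hasSum_gaussianVector hX).map ((innerₛₗ ℂ).flip (gaussianVector Y hY.1))
      (continuous_id.inner continuous_const)
  simp only [← Fock.toAntidual_apply, toAntidual_gaussianVector hY, gaussian_gaussianTerm] at hsum
  exact hsum.unique (hasSum_symInner_gaussianTerm hX hY)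

end Fock

end BosonicFock

theorem theorem5 {V : Type*} [NormedAddCommGroup V] [InnerProductSpace ℂ V]
    [FiniteDimensional ℂ V] (X Y : V →L⋆[ℂ] V)
    (hX : X ∈ BosonicFock.siegelDomain V) (hY : Y ∈ BosonicFock.siegelDomain V) :
    BosonicFock.gaussian X hX.1 ∈ LinearMap.range (BosonicFock.Fock.toAntidual V) ∧
    BosonicFock.gaussian Y hY.1 ∈ LinearMap.range (BosonicFock.Fock.toAntidual V) ∧
    (1 - Y.comp X : V →L[ℂ] V) ∈ BosonicFock.accretive V ∧
    ∀ Φ Ψ : BosonicFock.Fock V, BosonicFock.Fock.toAntidual V Φ = BosonicFock.gaussian X hX.1 →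
      BosonicFock.Fock.toAntidual V Ψ = BosonicFock.gaussian Y hY.1 →
      ⟪Φ, Ψ⟫_ℂ = (BosonicFock.detSqrt V (1 - Y.comp X))⁻¹ := by
  refine ⟨⟨_, BosonicFock.toAntidual_gaussianVector hX⟩,
    ⟨_, BosonicFock.toAntidual_gaussianVector hY⟩,
    BosonicFock.one_sub_mem_accretive (BosonicFock.norm_comp_lt_one hX.2 hY.2),
    fun Φ Ψ hΦ hΨ => ?_⟩
  rw [← BosonicFock.toAntidual_gaussianVector hX] at hΦ
  rw [← BosonicFock.toAntidual_gaussianVector hY] at hΨ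
  rw [BosonicFock.Fock.toAntidual_injective hΦ, BosonicFock.Fock.toAntidual_injective hΨ]
  exact BosonicFock.inner_gaussianVector hX hY
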